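/- Let $N\ge 1$, and let $|\Psi\rangle=\sum_{i=1}^{2}\sum_{j,k=1}^{N}\gamma_{ijk}\,|i\rangle\otimes|j\rangle\otimes|k\rangle$ be a (not necessarily normalized) pure state in $\mathbb{C}^2\otimes\mathbb{C}^N\otimes\mathbb{C}^N$, represented by the pair of $N\times N$ complex matrices $\Gamma_1=(\gamma_{1jk})_{j,k}$, $\Gamma_2=(\gamma_{2jk})_{j,k}$. Call $|\Psi\rangle$ truly entangled if the reduced density matrices $\rho_0,\rho_1,\rho_2$ of $|\Psi\rangle\langle\Psi|$ on the three factors have full rank, that is, $\operatorname{rank}\rho_0=2$ and $\operatorname{rank}\rho_1=\operatorname{rank}\rho_2=N$. For integers $n,l\ge 0$ let $C_{n,l}$ be the set of the states for which $$\max_{(\alpha,\beta)\neq(0,0)}\operatorname{rank}(\alpha\Gamma_1+\beta\Gamma_2)=n,\qquad \min_{(\alpha,\beta)\neq(0,0)}\operatorname{rank}(\alpha\Gamma_1+\beta\Gamma_2)=l,$$ where $\alpha,\beta$ range over $\mathbb{C}$. Suppose that $|\Psi\rangle$ is truly entangled and belongs to $C_{n,l}$. If $n<N$, then $$2(N-n)\le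 l\le n,\qquad\text{and hence}\qquad \frac{2N}{3}\le n<N.$$ If $n=N$, then $0<l<N$. -/

import Mathlib

/-- A (not necessarily normalized) pure state of a `2 × N × N` system, given by its coefficients
`γ i j k` in the product basis `|i⟩ ⊗ |j⟩ ⊗ |k⟩`. -/
abbrev TripartiteState (N : ℕ) : Type := Fin 2 → Fin N → Fin N → ℂ

namespace TripartiteState

variable {N : ℕ}

/-- The matrix `Γ₁` (for `i = 0`) or `Γ₂` (for `i = 1`) of the matrix pair representing the
state. -/
def slice (γ : TripartiteState N) (i : Fin 2) : Matrix (Fin N) (Fin N) ℂ :=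
  Matrix.of (γ i)

/-- The density matrix `|Ψ⟩⟨Ψ|`. -/
def density (γ : TripartiteState N) :
    Matrix (Fin 2 × Fin N × Fin N) (Fin 2 × Fin N × Fin N) ℂ :=
  Matrix.of fun x y => γ x.1 x.2.1 x.2.2 * star (γ y.1 y.2.1 y.2.2)

/-- The reduced density matrix of the qubit. -/
def reduced₀ (γ : TripartiteState N) : Matrix (Fin 2) (Fin 2) ℂ :=
  Matrix.of fun i i' => ∑ j, ∑ k, γ.density (i, j, k) (i', j, k)

/-- The reduced density matrix of the first `N`-dimensional party. -/
def reduced₁ (γ : TripartiteState N) : Matrix (Fin N) (Fin N) ℂ :=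
  Matrix.of fun j j' => ∑ i, ∑ k, γ.density (i, j, k) (i, j', k)

/-- The reduced density matrix of the second `N`-dimensional party. -/
def reduced₂ (γ : TripartiteState N) : Matrix (Fin N) (Fin N) ℂ :=
  Matrix.of fun k k' => ∑ i, ∑ j, γ.density (i, j, k) (i, j, k')

/-- A state is truly entangled when all its reduced density matrices have full rank. -/
def IsTrulyEntangled (γ : TripartiteState N) : Prop :=
  γ.reduced₀.rank = 2 ∧ γ.reduced₁.rank = N ∧ γ.reduced₂.rank = N

/-- The set of ranks of the matrices `α Γ₁ + β Γ₂` with `(α, β) ≠ (0, 0)`. -/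
def pencilRanks (γ : TripartiteState N) : Set ℕ :=
  {r | ∃ α β : ℂ, (α, β) ≠ (0, 0) ∧ (α • γ.slice 0 + β • γ.slice 1).rank = r}

/-- The set `C_{n,l}` of the states whose pencil `α Γ₁ + β Γ₂`, `(α, β) ≠ (0, 0)`, has maximal
rank `n` and minimal rank `l`. -/
def rankClass (N n l : ℕ) : Set (TripartiteState N) :=
  {γ | IsGreatest γ.pencilRanks n ∧ IsLeast γ.pencilRanks l}

end TripartiteState

/-! Let `A` have maximal rank `n` in the pencil and let `B` be independent of it. Maximality forces
`B (ker A) ⊆ range A`. Full rank of `ρ₂` makes the kernels of `A`, `B` meet trivially, and that of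
`ρ₁` makes their ranges span. So `B` embeds `ker A`, of dimension `N - n`, into `range A ⊓ range B`,
of dimension `n + rank B - N`, whence `rank B ≥ 2 (N - n)`. For `n = N`, an eigenvalue of `A⁻¹ B`
yields a singular matrix in the pencil, and full rank of `ρ₀` excludes the zero matrix. -/

open Module in
/-- If `f` has maximal rank among the maps `f + t • g`, then `g` maps the kernel of `f` into the
range of `f`. -/
theorem LinearMap.map_ker_le_range_of_finrank_range_le {V W : Type*}
    [AddCommGroup V] [Module ℂ V] [FiniteDimensional ℂ V]
    [NormedAddCommGroup W] [NormedSpace ℂ W] [FiniteDimensional ℂ W] (f g : V →ₗ[ℂ] W)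
    (h : ∀ t : ℂ, finrank ℂ (LinearMap.range (f + t • g)) ≤ finrank ℂ (LinearMap.range f)) :
    (LinearMap.ker f).map g ≤ LinearMap.range f := by
  rintro _ ⟨v, hv, rfl⟩
  by_contra hgv
  have hfv : f v = 0 := hv
  let b := finBasis ℂ (LinearMap.range f)
  choose u hu using fun i => (b i).2
  -- At `t = 0` this family is a basis of `range f` together with `g v ∉ range f`. Independence is
  -- an open condition, so it survives for some `t ≠ 0`, where `g v = (f + t • g) (t⁻¹ • v)`; the
  -- rank then exceeds that of `f`.
  let F : ℂ → Option (Fin (finrank ℂ (LinearMap.range f))) → W :=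
    fun t o => o.elim (g v) fun i => (f + t • g) (u i)
  have hF0 : LinearIndependent ℂ (F 0) := by
    rw [linearIndependent_option]
    have hsome : F 0 ∘ some = (LinearMap.range f).subtype ∘ b := by
      funext i
      simp [F, hu]
    rw [hsome]
    refine ⟨b.linearIndependent.map' _ (Submodule.ker_subtype _), fun hmem => hgv ?_⟩
    refine Submodule.span_le.2 ?_ hmem
    rintro _ ⟨i, rfl⟩
    exact (b i).2
  have hFc : Continuous F := by
    refine continuous_pi fun o => ?_
    cases o with
    | none => exact continuous_const
    | some i =>
      simp only [F, Option.elim, LinearMap.add_apply, LinearMap.smul_apply]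
      fun_prop
  have hev : ∀ᶠ t in nhdsWithin (0 : ℂ) {0}ᶜ, LinearIndependent ℂ (F t) :=
    (hFc.continuousAt.eventually hF0.eventually).filter_mono nhdsWithin_le_nhds
  obtain ⟨t, ht, ht0⟩ := (hev.and self_mem_nhdsWithin).exists
  have ht0 : t ≠ 0 := ht0
  have hmem : ∀ o, F t o ∈ LinearMap.range (f + t • g) := by
    intro o
    cases o with
    | none => exact ⟨t⁻¹ • v, by simp [F, hfv, ht0]⟩
    | some i => exact ⟨u i, rfl⟩
  have hle : Submodule.span ℂ (Set.range (F t)) ≤ LinearMap.range (f + t • g) :=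
    Submodule.span_le.2 (Set.range_subset_iff.2 hmem)
  have hcard := Submodule.finrank_mono hle
  rw [finrank_span_eq_card ht, Fintype.card_option, Fintype.card_fin] at hcard
  have := h t
  omega

open Module in
/-- Let `f` have maximal rank among the maps `f + t • g`. If `f` and `g` have no common kernel and
their ranges span the codomain, then the rank of `g` is at least the sum of the dimensions of the
kernel and of the cokernel of `f`. -/
theorem LinearMap.finrank_ker_add_finrank_le {V W : Type*}
    [AddCommGroup V] [Module ℂ V] [FiniteDimensional ℂ V]
    [NormedAddCommGroup W] [NormedSpace ℂ W] [FiniteDimensional ℂ W] (f g : V →ₗ[ℂ] W)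
    (h : ∀ t : ℂ, finrank ℂ (LinearMap.range (f + t • g)) ≤ finrank ℂ (LinearMap.range f))
    (hker : Disjoint (LinearMap.ker f) (LinearMap.ker g))
    (hrange : LinearMap.range f ⊔ LinearMap.range g = ⊤) :
    finrank ℂ (LinearMap.ker f) + finrank ℂ W ≤
      finrank ℂ (LinearMap.range f) + finrank ℂ (LinearMap.range g) := by
  have hle : (LinearMap.ker f).map g ≤ LinearMap.range f ⊓ LinearMap.range g :=
    le_inf (LinearMap.map_ker_le_range_of_finrank_range_le f g h) LinearMap.map_le_range
  have hmap : finrank ℂ ((LinearMap.ker f).map g) = finrank ℂ (LinearMap.ker f) := by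
    rw [← LinearMap.range_domRestrict]
    refine LinearMap.finrank_range_of_inj (LinearMap.ker_eq_bot.1 ?_)
    rw [LinearMap.ker_eq_bot']
    rintro ⟨x, hx⟩ hgx
    exact Subtype.ext (Submodule.disjoint_def.1 hker x hx hgx)
  have hsum := Submodule.finrank_sup_add_finrank_inf_eq (LinearMap.range f) (LinearMap.range g)
  rw [hrange, finrank_top] at hsum
  have := Submodule.finrank_mono hle
  omega

/-- A square matrix of full rank has no nonzero vector in its kernel. -/
theorem Matrix.eq_zero_of_mulVec_eq_zero_of_rank_eq {m : ℕ} {A : Matrix (Fin m) (Fin m) ℂ}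
    (hA : A.rank = m) {v : Fin m → ℂ} (hv : A.mulVec v = 0) : v = 0 := by
  have hsum := A.mulVecLin.finrank_range_add_finrank_ker
  rw [Module.finrank_fin_fun, show Module.finrank ℂ (LinearMap.range A.mulVecLin) = m from hA]
    at hsum
  have hbot : LinearMap.ker A.mulVecLin = ⊥ := Submodule.finrank_eq_zero.1 (by omega)
  exact (LinearMap.ker_eq_bot'.1 hbot) v hv

/-- A square matrix with a nonzero vector in its kernel does not have full rank. -/
theorem Matrix.rank_lt_of_mulVec_eq_zero {m : ℕ} {A : Matrix (Fin m) (Fin m) ℂ}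
    {v : Fin m → ℂ} (hv : A.mulVec v = 0) (hv0 : v ≠ 0) : A.rank < m :=
  lt_of_le_of_ne (by simpa using A.rank_le_width) fun h =>
    hv0 (Matrix.eq_zero_of_mulVec_eq_zero_of_rank_eq h hv)

/-- A matrix pencil spanned by an invertible matrix `A` and a matrix `B` contains a singular
matrix `B - μ A`. -/
theorem Matrix.exists_rank_sub_smul_lt {m : ℕ} (hm : m ≠ 0) {A : Matrix (Fin m) (Fin m) ℂ}
    (hA : A.rank = m) (B : Matrix (Fin m) (Fin m) ℂ) : ∃ μ : ℂ, (B - μ • A).rank < m := by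
  have : NeZero m := ⟨hm⟩
  have hunit : IsUnit A.det := by
    rw [isUnit_iff_ne_zero]
    intro hdet
    obtain ⟨v, hv0, hv⟩ := Matrix.exists_mulVec_eq_zero_iff.2 hdet
    exact hv0 (Matrix.eq_zero_of_mulVec_eq_zero_of_rank_eq hA hv)
  obtain ⟨μ, hμ⟩ := Module.End.exists_eigenvalue (Matrix.mulVecLin (A⁻¹ * B))
  obtain ⟨v, hv⟩ := hμ.exists_hasEigenvector
  refine ⟨μ, Matrix.rank_lt_of_mulVec_eq_zero (v := v) ?_ hv.2⟩
  have hev : (A⁻¹ * B).mulVec v = μ • v := hv.apply_eq_smul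
  have h2 := congrArg A.mulVec hev
  rw [Matrix.mulVec_mulVec, ← Matrix.mul_assoc, Matrix.mul_nonsing_inv A hunit, Matrix.one_mul,
    Matrix.mulVec_smul] at h2
  rw [Matrix.sub_mulVec, Matrix.smul_mulVec, h2, sub_self]

namespace TripartiteState

variable {N : ℕ} {γ : TripartiteState N}

/-- The matrix `α Γ₁ + β Γ₂`. -/
def pencil (γ : TripartiteState N) (α β : ℂ) : Matrix (Fin N) (Fin N) ℂ :=
  α • γ.slice 0 + β • γ.slice 1

theorem reduced₁_eq (γ : TripartiteState N) :
    γ.reduced₁ = γ.slice 0 * (γ.slice 0).conjTranspose + γ.slice 1 * (γ.slice 1).conjTranspose := by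
  ext j j'
  simp [reduced₁, density, slice, Matrix.mul_apply, Fin.sum_univ_two]

theorem transpose_reduced₂_eq (γ : TripartiteState N) :
    γ.reduced₂.transpose =
      (γ.slice 0).conjTranspose * γ.slice 0 + (γ.slice 1).conjTranspose * γ.slice 1 := by
  ext k k'
  simp [reduced₂, density, slice, Matrix.mul_apply, Fin.sum_univ_two, mul_comm]

/-- A vanishing combination of the slices is a null vector of `ρ₀ᵀ`. -/
theorem IsTrulyEntangled.pencil_ne_zero (hγ : γ.IsTrulyEntangled) {α β : ℂ}
    (h : (α, β) ≠ (0, 0)) : γ.pencil α β ≠ 0 := by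
  intro h0
  have hz : γ.reduced₀.transpose.mulVec ![α, β] = 0 := by
    have hjk : ∀ j k, α * γ 0 j k + β * γ 1 j k = 0 := fun j k => by
      simpa [pencil, slice] using congrFun (congrFun h0 j) k
    funext i
    simp only [Matrix.mulVec, dotProduct, Fin.sum_univ_two, Matrix.transpose_apply, reduced₀,
      density, Matrix.of_apply, Matrix.cons_val_zero, Matrix.cons_val_one, Finset.sum_mul,
      ← Finset.sum_add_distrib, Pi.zero_apply]
    refine Finset.sum_eq_zero fun j _ => Finset.sum_eq_zero fun k _ => ?_
    linear_combination star (γ i j k) * hjk j k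
  have hv := Matrix.eq_zero_of_mulVec_eq_zero_of_rank_eq
    ((Matrix.rank_transpose _).trans hγ.1) hz
  exact h (Prod.ext (by simpa using congrFun hv 0) (by simpa using congrFun hv 1))

theorem IsTrulyEntangled.ne_zero (hγ : γ.IsTrulyEntangled) : N ≠ 0 := by
  rintro rfl
  exact hγ.pencil_ne_zero (α := 1) (β := 0) (by simp) (Subsingleton.elim _ _)

/-- Cramer's rule. -/
theorem slice_zero_eq (γ : TripartiteState N) {a b c d : ℂ} (h : a * d - b * c ≠ 0) :
    γ.slice 0 = (d / (a * d - b * c)) • γ.pencil a b - (b / (a * d - b * c)) • γ.pencil c d := by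
  ext j k
  simp only [pencil, Matrix.sub_apply, Matrix.smul_apply, Matrix.add_apply, smul_eq_mul]
  rw [div_mul_eq_mul_div, div_mul_eq_mul_div, ← sub_div, eq_div_iff h]
  ring

theorem slice_one_eq (γ : TripartiteState N) {a b c d : ℂ} (h : a * d - b * c ≠ 0) :
    γ.slice 1 = (a / (a * d - b * c)) • γ.pencil c d - (c / (a * d - b * c)) • γ.pencil a b := by
  ext j k
  simp only [pencil, Matrix.sub_apply, Matrix.smul_apply, Matrix.add_apply, smul_eq_mul]
  rw [div_mul_eq_mul_div, div_mul_eq_mul_div, ← sub_div, eq_div_iff h]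
  ring

/-- A common null vector is killed by both slices, hence by `ρ₂ᵀ = ∑ Γᵢ† Γᵢ`. -/
theorem IsTrulyEntangled.disjoint_ker (hγ : γ.IsTrulyEntangled) {a b c d : ℂ}
    (h : a * d - b * c ≠ 0) :
    Disjoint (LinearMap.ker (γ.pencil a b).mulVecLin)
      (LinearMap.ker (γ.pencil c d).mulVecLin) := by
  rw [Submodule.disjoint_def]
  intro v h1 h2
  have h1 : (γ.pencil a b).mulVec v = 0 := h1
  have h2 : (γ.pencil c d).mulVec v = 0 := h2
  have hs0 : (γ.slice 0).mulVec v = 0 := by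
    rw [γ.slice_zero_eq h, Matrix.sub_mulVec, Matrix.smul_mulVec, Matrix.smul_mulVec, h1, h2]
    simp
  have hs1 : (γ.slice 1).mulVec v = 0 := by
    rw [γ.slice_one_eq h, Matrix.sub_mulVec, Matrix.smul_mulVec, Matrix.smul_mulVec, h1, h2]
    simp
  refine Matrix.eq_zero_of_mulVec_eq_zero_of_rank_eq
    ((Matrix.rank_transpose _).trans hγ.2.2) ?_
  rw [transpose_reduced₂_eq, Matrix.add_mulVec, ← Matrix.mulVec_mulVec, ← Matrix.mulVec_mulVec,
    hs0, hs1]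
  simp

/-- Both slices map into the sum of the ranges, hence so does the surjective `ρ₁ = ∑ Γᵢ Γᵢ†`. -/
theorem IsTrulyEntangled.range_sup_range (hγ : γ.IsTrulyEntangled) {a b c d : ℂ}
    (h : a * d - b * c ≠ 0) :
    LinearMap.range (γ.pencil a b).mulVecLin ⊔ LinearMap.range (γ.pencil c d).mulVecLin = ⊤ := by
  set S := LinearMap.range (γ.pencil a b).mulVecLin ⊔ LinearMap.range (γ.pencil c d).mulVecLin
  have h1 : ∀ v, (γ.pencil a b).mulVec v ∈ S := fun v => Submodule.mem_sup_left ⟨v, rfl⟩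
  have h2 : ∀ v, (γ.pencil c d).mulVec v ∈ S := fun v => Submodule.mem_sup_right ⟨v, rfl⟩
  have hs0 : ∀ v, (γ.slice 0).mulVec v ∈ S := fun v => by
    rw [γ.slice_zero_eq h, Matrix.sub_mulVec, Matrix.smul_mulVec, Matrix.smul_mulVec]
    exact S.sub_mem (S.smul_mem _ (h1 v)) (S.smul_mem _ (h2 v))
  have hs1 : ∀ v, (γ.slice 1).mulVec v ∈ S := fun v => by
    rw [γ.slice_one_eq h, Matrix.sub_mulVec, Matrix.smul_mulVec, Matrix.smul_mulVec]
    exact S.sub_mem (S.smul_mem _ (h2 v)) (S.smul_mem _ (h1 v))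
  have htop : LinearMap.range γ.reduced₁.mulVecLin = ⊤ :=
    Submodule.eq_top_of_finrank_eq ((show _ = N from hγ.2.1).trans (by simp))
  rw [eq_top_iff, ← htop]
  rintro _ ⟨v, rfl⟩
  rw [Matrix.mulVecLin_apply, reduced₁_eq, Matrix.add_mulVec, ← Matrix.mulVec_mulVec,
    ← Matrix.mulVec_mulVec]
  exact S.add_mem (hs0 _) (hs1 _)

/-- A matrix of the pencil that is independent of a matrix of maximal rank `n` has rank at least
`2 (N - n)`. -/
theorem IsTrulyEntangled.two_mul_le (hγ : γ.IsTrulyEntangled) {a b c d : ℂ}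
    (h : a * d - b * c ≠ 0)
    (hmax : ∀ α β : ℂ, (α, β) ≠ (0, 0) → (γ.pencil α β).rank ≤ (γ.pencil a b).rank) :
    2 * N ≤ 2 * (γ.pencil a b).rank + (γ.pencil c d).rank := by
  have hkey := LinearMap.finrank_ker_add_finrank_le (γ.pencil a b).mulVecLin
    (γ.pencil c d).mulVecLin ?_ (hγ.disjoint_ker h) (hγ.range_sup_range h)
  · have hsum := (γ.pencil a b).mulVecLin.finrank_range_add_finrank_ker
    rw [Module.finrank_fin_fun] at hkey hsum
    simp only [Matrix.rank]
    omega
  · intro t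
    have hlin : (γ.pencil a b).mulVecLin + t • (γ.pencil c d).mulVecLin =
        (γ.pencil (a + t * c) (b + t * d)).mulVecLin := by
      refine LinearMap.ext fun x => ?_
      simp only [pencil, LinearMap.add_apply, LinearMap.smul_apply,
        Matrix.mulVecLin_apply, Matrix.add_mulVec, Matrix.smul_mulVec]
      module
    rw [hlin]
    refine hmax _ _ fun h0 => h ?_
    obtain ⟨h1, h2⟩ := Prod.mk.inj h0
    linear_combination d * h1 - c * h2

/-- Every nonzero `(a, b)` extends to a basis of `ℂ²`. -/
theorem exists_det_ne_zero {a b : ℂ} (h : (a, b) ≠ (0, 0)) :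
    ∃ c d : ℂ, a * d - b * c ≠ 0 := by
  by_cases ha : a = 0
  · have hb : b ≠ 0 := fun hb => h (by rw [ha, hb])
    exact ⟨1, 0, by simpa using hb⟩
  · exact ⟨0, 1, by simpa using ha⟩

/-- Proportional parameters give matrices of the same rank. -/
theorem rank_pencil_eq_of_det_eq_zero (γ : TripartiteState N) {a b c d : ℂ}
    (hab : (a, b) ≠ (0, 0)) (hcd : (c, d) ≠ (0, 0)) (h : a * d - b * c = 0) :
    (γ.pencil c d).rank = (γ.pencil a b).rank := by
  obtain ⟨t, hc, hd⟩ : ∃ t : ℂ, c = t * a ∧ d = t * b := by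
    by_cases ha : a = 0
    · have hb : b ≠ 0 := fun hb => hab (by rw [ha, hb])
      have hc : c = 0 := by simpa [ha, hb] using h
      exact ⟨d / b, by simp [ha, hc], by field_simp⟩
    · refine ⟨c / a, by field_simp, ?_⟩
      field_simp
      linear_combination h
  have ht : t ≠ 0 := by
    rintro rfl
    exact hcd (by simp [hc, hd])
  have hsmul : γ.pencil c d = t • γ.pencil a b := by
    rw [hc, hd]
    simp only [pencil]
    module
  rw [hsmul]
  exact Matrix.rank_smul_of_mem_nonZeroDivisors _ (mem_nonZeroDivisors_of_ne_zero ht)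

end TripartiteState

theorem mainTheorem3 (N n l : ℕ) (γ : TripartiteState N) (hγ : γ.IsTrulyEntangled)
    (hC : γ ∈ TripartiteState.rankClass N n l) :
    (n < N → (2 * ((N : ℤ) - (n : ℤ)) ≤ (l : ℤ) ∧ l ≤ n) ∧ 2 * (N : ℝ) / 3 ≤ (n : ℝ)) ∧
      (n = N → 0 < l ∧ l < N) := by
  obtain ⟨⟨⟨a, b, hab, hn⟩, hub⟩, ⟨⟨c, d, hcd, hl⟩, hlb⟩⟩ := hC
  change (γ.pencil a b).rank = n at hn
  change (γ.pencil c d).rank = l at hl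
  have hmax : ∀ α β : ℂ, (α, β) ≠ (0, 0) → (γ.pencil α β).rank ≤ n :=
    fun α β h => hub ⟨α, β, h, rfl⟩
  have hmin : ∀ α β : ℂ, (α, β) ≠ (0, 0) → l ≤ (γ.pencil α β).rank :=
    fun α β h => hlb ⟨α, β, h, rfl⟩
  have hln : l ≤ n := hn ▸ hmin a b hab
  obtain ⟨c', d', hdet'⟩ := TripartiteState.exists_det_ne_zero hab
  refine ⟨fun _ => ?_, ?_⟩
  · have hbound : 2 * N ≤ 2 * n + l := by
      rw [← hn] at hmax ⊢
      -- If the minimizer is proportional to the maximizer, then `l = n`, and any independent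
      -- matrix, of rank at most `n`, gives the bound.
      by_cases hdet : a * d - b * c = 0
      · have hcd' : (c', d') ≠ (0, 0) := by
          intro h0
          obtain ⟨rfl, rfl⟩ := Prod.mk.inj h0
          simp at hdet'
        have hle := hmax c' d' hcd'
        have hkey := hγ.two_mul_le hdet' hmax
        have heq := γ.rank_pencil_eq_of_det_eq_zero hab hcd hdet
        omega
      · exact hl ▸ hγ.two_mul_le hdet hmax
    refine ⟨⟨by omega, hln⟩, ?_⟩
    have h3 : 2 * N ≤ 3 * n := by omega
    have h3' : 2 * (N : ℝ) ≤ 3 * n := by exact_mod_cast h3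
    linarith
  · rintro rfl
    refine ⟨Nat.pos_of_ne_zero fun h0 => ?_, ?_⟩
    · have hbot : LinearMap.range (γ.pencil c d).mulVecLin = ⊥ :=
        Submodule.finrank_eq_zero.1 (hl.trans h0)
      refine hγ.pencil_ne_zero hcd (Matrix.ext_of_mulVec_single fun i => ?_)
      rw [Matrix.zero_mulVec]
      exact LinearMap.congr_fun (LinearMap.range_eq_bot.1 hbot) _
    · obtain ⟨μ, hμ⟩ := Matrix.exists_rank_sub_smul_lt hγ.ne_zero hn (γ.pencil c' d')
      have heq : γ.pencil c' d' - μ • γ.pencil a b = γ.pencil (c' - μ * a) (d' - μ * b) := by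
        simp only [TripartiteState.pencil]
        module
      rw [heq] at hμ
      -- Subtracting `μ • (a, b)` preserves the determinant, so the new parameters are nonzero.
      refine (hmin _ _ fun h0 => hdet' ?_).trans_lt hμ
      obtain ⟨h1, h2⟩ := Prod.mk.inj h0
      linear_combination a * h2 - b * h1
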